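/- Let $n\ge 1$, let $p:\mathbb{R}^n\to[1,+\infty)$ be a measurable function, and set $p^-:=\operatorname{ess\,inf}_{\mathbb{R}^n}p$ and $p^+:=\operatorname{ess\,sup}_{\mathbb{R}^n}p$. Assume $1<p^-\le p^+<+\infty$. Let $W^{1,p^\pm}(\mathbb{R}^n):=W^{1,p^+}(\mathbb{R}^n)\cap W^{1,p^-}(\mathbb{R}^n)$, where $W^{1,q}(\mathbb{R}^n)$ is the Sobolev space of real-valued functions in $L^q(\mathbb{R}^n)$ whose weak gradient belongs to $L^q(\mathbb{R}^n)$. For $x\in\mathbb{R}^n$ set $$K_{n,p(x)}:=\frac1{p(x)}\int_{\mathbb{S}^{n-1}}|\omega\cdot \boldsymbol{e}|^{p(x)}\,d\mathcal{H}^{n-1}(\omega),$$ where $\boldsymbol{e}\in\mathbb{S}^{n-1}$ is any unit vector (the value does not depend on its choice) and $\mathcal H^{n-1}$ is the surface measure on the unit sphere $\mathbb{S}^{n-1}$. Then for every $u\in W^{1,p^\pm}(\mathbb{R}^n)$, with weak gradient $\nabla u$, $$\lim_{\delta\to0^+}\ \iint_{\{(x,y)\in\mathbb{R}^n\times\mathbb{R}^n:\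 |u(x)-u(y)|>\delta\}}\frac{p(x)\,\delta^{p(x)}}{|x-y|^{n+p(x)}}\,dx\,dy=\int_{\mathbb{R}^n}p(x)\,K_{n,p(x)}\,|\nabla u(x)|^{p(x)}\,dx .$$ In particular, the limit exists and is finite. -/

import Mathlib

open MeasureTheory Filter Topology
open scoped ENNReal

noncomputable section

namespace VarExp

/-- `g` is a weak gradient of `u` on `ℝⁿ`: both are locally integrable, and integration by parts
holds against every smooth compactly supported test function, in every direction `v`. -/
structure HasWeakGradient {n : ℕ} (u : EuclideanSpace ℝ (Fin n) → ℝ)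
    (g : EuclideanSpace ℝ (Fin n) → EuclideanSpace ℝ (Fin n)) : Prop where
  locallyIntegrable : LocallyIntegrable u volume
  locallyIntegrable_grad : LocallyIntegrable g volume
  integral_eq : ∀ φ : EuclideanSpace ℝ (Fin n) → ℝ, ContDiff ℝ (⊤ : ℕ∞) φ → HasCompactSupport φ →
    ∀ v : EuclideanSpace ℝ (Fin n),
      ∫ x, u x * fderiv ℝ φ x v = - ∫ x, φ x * inner ℝ (g x) v

/-- The Sobolev space `W^{1,q}(ℝⁿ)`, as a predicate on (representatives of) functions. -/
def MemW1 {n : ℕ} (q : ℝ≥0∞) (u : EuclideanSpace ℝ (Fin n) → ℝ) : Prop :=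
  MemLp u q volume ∧
    ∃ g : EuclideanSpace ℝ (Fin n) → EuclideanSpace ℝ (Fin n),
      HasWeakGradient u g ∧ MemLp g q volume

/-- `p⁻`, the essential infimum of the exponent. It is taken in `[0,∞]`. -/
def pMinus {n : ℕ} (p : EuclideanSpace ℝ (Fin n) → ℝ) : ℝ≥0∞ :=
  essInf (fun x => ENNReal.ofReal (p x)) volume

/-- `p⁺`, the essential supremum of the exponent. It is taken in `[0,∞]`, so that it is `∞` when
`p` is not essentially bounded. -/
def pPlus {n : ℕ} (p : EuclideanSpace ℝ (Fin n) → ℝ) : ℝ≥0∞ :=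
  essSup (fun x => ENNReal.ofReal (p x)) volume

/-- The space `W^{1,p^±}(ℝⁿ) = W^{1,p⁺}(ℝⁿ) ∩ W^{1,p⁻}(ℝⁿ)`. -/
def MemW1pm {n : ℕ} (p : EuclideanSpace ℝ (Fin n) → ℝ)
    (u : EuclideanSpace ℝ (Fin n) → ℝ) : Prop :=
  MemW1 (pPlus p) u ∧ MemW1 (pMinus p) u

/-- The constant `K_{n,q} = (1/q) ∫_{S^{n-1}} |ω · e|^q dH^{n-1}(ω)`, computed with the unit
vector `e`. Here `volume.toSphere` is the usual surface measure on the unit sphere. -/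
def K {n : ℕ} (e : Metric.sphere (0 : EuclideanSpace ℝ (Fin n)) 1) (q : ℝ) : ℝ :=
  (1 / q) * ∫ ω : Metric.sphere (0 : EuclideanSpace ℝ (Fin n)) 1,
    |inner ℝ (ω : EuclideanSpace ℝ (Fin n)) (e : EuclideanSpace ℝ (Fin n))| ^ q
      ∂((volume : Measure (EuclideanSpace ℝ (Fin n))).toSphere)

/-- The nonlocal functional
`∬_{|u(x)-u(y)|>δ} p(x) δ^{p(x)} / |x-y|^{n+p(x)} dx dy`, with values in `[0,∞]`. -/
def nonlocalEnergy {n : ℕ} (p u : EuclideanSpace ℝ (Fin n) → ℝ) (δ : ℝ) : ℝ≥0∞ :=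
  ∫⁻ y, ∫⁻ x in {x | δ < |u x - u y|},
    ENNReal.ofReal (p x * δ ^ p x / ‖x - y‖ ^ ((n : ℝ) + p x))

end VarExp

end

/-! Substituting `y = x + δhω` with `ω` in the sphere and `h > 0`, all powers of `δ` cancel: the
energy becomes the integral of `p(x) h^(-1-p(x))` over the triples `(ω, h, x)` with `|u(x + δhω) -
u(x)| > δ`. As `δ → 0` this region tends to `h |∇u(x)·ω| > 1`. Integrating the limit in `h` gives
`|∇u(x)·ω|^p(x)`, and then integrating in `ω` gives `p(x) K |∇u(x)|^p(x)`. It remains to justify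
pointwise convergence and domination.

Convergence: the increments of `u` are line integrals of its weak gradient
(`HasWeakGradient.ae_sub_eq_integral`), so Lebesgue differentiation on lines gives almost everywhere
convergence of directional difference quotients along any fixed sequence `δ → 0`
(`ae_tendsto_integral_line`).

Domination: if the increment exceeds `δ`, some one-sided average of `|∇u|` from `x` in direction
`ω`, over a dyadic length, exceeds `1/(2h)`, a condition free of `δ`. A weak type bound, uniform in
`ω`, is transferred from the line; applied to the part of `|∇u|` above half the level and integrated
in `h`, it makes this majorant integrable (`lintegral_rpow_mul_measure_dyadicExceed_le`). The
exponent is handled by `h^(-1-p(x)) ≤ h^(-1-p⁻) + h^(-1-p⁺)`, and `p⁻ > 1` is what makes the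
integrals in `h` converge. -/

/-! ### Directional maximal inequalities -/

namespace VarExp
open Set

/-- One-sided Hardy–Littlewood weak type inequality on the line. -/
theorem mul_volume_average_gt_le (f : ℝ → ℝ≥0∞) {c : ℝ} (hc : 0 < c) :
    ENNReal.ofReal c * volume {t : ℝ | ∃ r > 0,
      ENNReal.ofReal (c * r) < ∫⁻ s in Ioc t (t + r), f s} ≤ 10 * ∫⁻ s, f s := by
  by_cases hI : ∫⁻ s, f s = ∞
  · simp [hI]
  set S : Set ℝ := {t : ℝ | ∃ r > 0, ENNReal.ofReal (c * r) < ∫⁻ s in Ioc t (t + r), f s} with hS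
  have hmem : ∀ t ∈ S, ∃ r > 0, ENNReal.ofReal (c * r) < ∫⁻ s in Ioc t (t + r), f s :=
    fun t ht => ht
  choose! r hr hlt using hmem
  -- A finite integral bounds the radii, as the Vitali covering argument requires.
  have hbound : ∀ t ∈ S, r t ≤ (∫⁻ s, f s).toReal / c := by
    intro t ht
    rw [le_div_iff₀ hc, mul_comm]
    have h1 := (hlt t ht).le.trans (setLIntegral_le_lintegral (Ioc t (t + r t)) f)
    exact (ENNReal.ofReal_le_iff_le_toReal hI).1 h1
  obtain ⟨u, huS, hd, hcov⟩ := Vitali.exists_disjoint_subfamily_covering_enlargement_closedBall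
    S (fun t => t) r _ hbound 5 (by norm_num)
  have hcount : u.Countable := by
    refine hd.countable_of_nonempty_interior fun t ht => ?_
    refine ⟨t, Metric.ball_subset_interior_closedBall (Metric.mem_ball_self (hr t (huS ht)))⟩
  have hsub : S ⊆ ⋃ b ∈ u, Metric.closedBall b (5 * r b) := by
    intro t ht
    obtain ⟨b, hb, hsubset⟩ := hcov t ht
    exact mem_biUnion hb (hsubset (Metric.mem_closedBall_self (hr t ht).le))
  have hIoc : ∀ b ∈ u, Ioc b (b + r b) ⊆ Metric.closedBall b (r b) := by
    intro b hb s hs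
    rw [Real.closedBall_eq_Icc]
    exact ⟨by linarith [hs.1, hr b (huS hb)], hs.2⟩
  calc ENNReal.ofReal c * volume S
      ≤ ENNReal.ofReal c * ∑' b : u, volume (Metric.closedBall (b : ℝ) (5 * r b)) := by
        gcongr
        exact (measure_mono hsub).trans (measure_biUnion_le _ hcount _)
    -- The constant 10 is the length of a ball of radius `5 * r b`, divided by `r b`.
    _ = ∑' b : u, 10 * ENNReal.ofReal (c * r b) := by
        rw [← ENNReal.tsum_mul_left]
        refine tsum_congr fun b => ?_
        rw [Real.volume_closedBall, ← ENNReal.ofReal_mul hc.le,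
          show (10 : ℝ≥0∞) = ENNReal.ofReal 10 by norm_num, ← ENNReal.ofReal_mul (by norm_num)]
        congr 1
        ring
    _ ≤ ∑' b : u, 10 * ∫⁻ s in Ioc (b : ℝ) (b + r b), f s := by
        refine ENNReal.tsum_le_tsum fun b => ?_
        gcongr
        exact (hlt b (huS b.2)).le
    _ = 10 * ∫⁻ s in ⋃ b ∈ u, Ioc b (b + r b), f s := by
        rw [ENNReal.tsum_mul_left, lintegral_biUnion hcount (fun _ _ => measurableSet_Ioc)]
        exact hd.mono_on hIoc
    _ ≤ 10 * ∫⁻ s, f s := by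
        gcongr
        exact Measure.restrict_le_self

variable {E : Type*} [NormedAddCommGroup E] [NormedSpace ℝ E] [MeasurableSpace E] [BorelSpace E]
  [SecondCountableTopology E]

/-- The points at which some dyadic one-sided average of `f` in direction `ω` exceeds `c`. -/
def dyadicExceed (f : E → ℝ≥0∞) (ω : E) (c : ℝ) : Set E :=
  {x | ∃ k : ℤ, ENNReal.ofReal (c * 2 ^ k) < ∫⁻ s in Ioc (0 : ℝ) (2 ^ k), f (x + s • ω)}

theorem measurable_setLIntegral_line {f : E → ℝ≥0∞} (hf : Measurable f) (A : Set ℝ) :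
    Measurable fun q : E × E => ∫⁻ s in A, f (q.1 + s • q.2) := by
  refine Measurable.lintegral_prod_right' (f := fun q : (E × E) × ℝ => f (q.1.1 + q.2 • q.1.2)) ?_
  fun_prop

theorem measurableSet_dyadicExceed {f : E → ℝ≥0∞} (hf : Measurable f) :
    MeasurableSet {q : (E × ℝ) × E | q.2 ∈ dyadicExceed f q.1.1 q.1.2} := by
  have : {q : (E × ℝ) × E | q.2 ∈ dyadicExceed f q.1.1 q.1.2} = ⋃ k : ℤ,
      {q | ENNReal.ofReal (q.1.2 * 2 ^ k) <
        ∫⁻ s in Ioc (0 : ℝ) (2 ^ k), f (q.2 + s • q.1.1)} := by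
    ext q
    simp [dyadicExceed]
  rw [this]
  refine MeasurableSet.iUnion fun k => measurableSet_lt (by fun_prop) ?_
  exact (measurable_setLIntegral_line hf _).comp
    (f := fun q : (E × ℝ) × E => (q.2, q.1.1)) (by fun_prop)

theorem setLIntegral_Ioc_add_line (f : ℝ → ℝ≥0∞) (t r : ℝ) :
    ∫⁻ s in Ioc (0 : ℝ) r, f (t + s) = ∫⁻ s in Ioc t (t + r), f s := by
  have h := (measurePreserving_add_left (volume : Measure ℝ) t).setLIntegral_comp_preimage_emb
    (measurableEmbedding_addLeft t) f (Ioc t (t + r))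
  rw [← h]
  congr 2
  ext s
  simp

variable (μ : Measure E) [μ.IsAddLeftInvariant] [SFinite μ]


/-- Fubini and translation invariance: each slice in `s` has the same integral. -/
theorem lintegral_setLIntegral_line {f : E → ℝ≥0∞} (hf : Measurable f) (ω : E) (A : Set ℝ) :
    ∫⁻ x, (∫⁻ s in A, f (x + s • ω)) ∂μ = volume A * ∫⁻ x, f x ∂μ := by
  rw [lintegral_lintegral_swap (by fun_prop)]
  have : ∀ s : ℝ, ∫⁻ x, f (x + s • ω) ∂μ = ∫⁻ x, f x ∂μ := fun s => by
    simpa [add_comm] using lintegral_add_left_eq_self (μ := μ) f (s • ω)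
  simp [this, mul_comm]

/-- Weak type inequality for the directional maximal function, by transference from the line. -/
theorem mul_measure_dyadicExceed_le {f : E → ℝ≥0∞} (hf : Measurable f) (ω : E) {c : ℝ}
    (hc : 0 < c) :
    ENNReal.ofReal c * μ (dyadicExceed f ω c) ≤ 20 * ∫⁻ x, f x ∂μ := by
  -- Capping the lengths at `T = 2 ^ N` keeps every average started in `(0, T]` inside `(0, 2T]`, so
  -- that the line inequality can be localized.
  let S : ℕ → Set E := fun N => {x | ∃ k : ℤ, k ≤ N ∧
    ENNReal.ofReal (c * 2 ^ k) < ∫⁻ s in Ioc (0 : ℝ) (2 ^ k), f (x + s • ω)}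
  have hmono : Monotone S := by
    rintro M N hMN x ⟨k, hk, hx⟩
    exact ⟨k, hk.trans (by exact_mod_cast hMN), hx⟩
  have hunion : dyadicExceed f ω c = ⋃ N, S N := by
    ext x
    simp only [dyadicExceed, mem_ofPred_eq, mem_iUnion, S]
    constructor
    · rintro ⟨k, hk⟩
      exact ⟨k.toNat, k, Int.self_le_toNat k, hk⟩
    · rintro ⟨N, k, -, hk⟩
      exact ⟨k, hk⟩
  rw [hunion, hmono.measure_iUnion, ENNReal.mul_iSup]
  refine iSup_le fun N => ?_
  have hSmeas : MeasurableSet (S N) := by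
    have : S N = ⋃ k : ℤ, ⋃ _ : k ≤ N, {x | ENNReal.ofReal (c * 2 ^ k) <
        ∫⁻ s in Ioc (0 : ℝ) (2 ^ k), f (x + s • ω)} := by
      ext x
      simp [S]
    rw [this]
    refine MeasurableSet.iUnion fun k => MeasurableSet.iUnion fun _ =>
      measurableSet_lt measurable_const ?_
    exact (measurable_setLIntegral_line hf _).comp (f := fun x : E => (x, ω)) (by fun_prop)
  set T : ℝ := 2 ^ N with hT
  have hT0 : 0 < T := by positivity
  have key : ∀ x : E, ENNReal.ofReal c * ∫⁻ s in Ioc 0 T, (S N).indicator 1 (x + s • ω)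
      ≤ 10 * ∫⁻ s in Ioc 0 (2 * T), f (x + s • ω) := by
    intro x
    have h1 := mul_volume_average_gt_le ((Ioc 0 (2 * T)).indicator fun s => f (x + s • ω)) hc
    rw [lintegral_indicator measurableSet_Ioc] at h1
    refine le_trans ?_ h1
    gcongr
    have h2 : ∀ s : ℝ, (S N).indicator (1 : E → ℝ≥0∞) (x + s • ω)
        = ((fun s : ℝ => x + s • ω) ⁻¹' S N).indicator 1 s := fun s => rfl
    simp_rw [h2]
    have hpre : MeasurableSet ((fun s : ℝ => x + s • ω) ⁻¹' S N) :=
      hSmeas.preimage (by fun_prop)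
    rw [lintegral_indicator_one hpre, Measure.restrict_apply hpre]
    refine measure_mono ?_
    rintro t ⟨⟨k, hk, hlt⟩, ht⟩
    have hkT : (2 : ℝ) ^ k ≤ T := by
      rw [hT, ← zpow_natCast]
      exact zpow_le_zpow_right₀ (by norm_num) hk
    refine ⟨2 ^ k, by positivity, hlt.trans_eq ?_⟩
    have h3 : ∀ s : ℝ, f (x + t • ω + s • ω) = (fun s : ℝ => f (x + s • ω)) (t + s) := fun s => by
      simp only [add_smul, add_assoc]
    simp_rw [h3]
    rw [setLIntegral_Ioc_add_line (fun s : ℝ => f (x + s • ω))]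
    refine setLIntegral_congr_fun measurableSet_Ioc fun s hs => ?_
    rw [indicator_of_mem]
    exact ⟨ht.1.trans hs.1, by linarith [hs.2, ht.2]⟩
  have h4 := lintegral_mono (μ := μ) key
  have hind : Measurable ((S N).indicator (1 : E → ℝ≥0∞)) := measurable_one.indicator hSmeas
  rw [lintegral_const_mul _ (by
      exact (measurable_setLIntegral_line hind _).comp (f := fun x : E => (x, ω)) (by fun_prop)),
    lintegral_const_mul _ (by
      exact (measurable_setLIntegral_line hf _).comp (f := fun x : E => (x, ω)) (by fun_prop)),
    lintegral_setLIntegral_line μ hind, lintegral_setLIntegral_line μ hf,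
    lintegral_indicator_one hSmeas, Real.volume_Ioc, Real.volume_Ioc, sub_zero, sub_zero,
    ENNReal.ofReal_mul (by norm_num : (0 : ℝ) ≤ 2)] at h4
  -- Integrating `key` over `x` gives a factor `T` on the left and `2T` on the right; cancelling `T`
  -- leaves `20 = 10 * 2`.
  have hTne : ENNReal.ofReal T ≠ 0 := by simpa using hT0
  refine (ENNReal.mul_le_mul_iff_right hTne ENNReal.ofReal_ne_top).1 ?_
  calc ENNReal.ofReal T * (ENNReal.ofReal c * μ (S N))
      = ENNReal.ofReal c * (ENNReal.ofReal T * μ (S N)) := by ring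
    _ ≤ _ := h4
    _ = _ := by
      rw [show (20 : ℝ≥0∞) = 10 * ENNReal.ofReal 2 by norm_num]
      ring

/-- Weak type inequality involving only the values of `f` above half the level. -/
theorem mul_measure_dyadicExceed_le_indicator {f : E → ℝ≥0∞} (hf : Measurable f) (ω : E) {c : ℝ}
    (hc : 0 < c) :
    ENNReal.ofReal c * μ (dyadicExceed f ω c) ≤
      40 * ∫⁻ x, {x | ENNReal.ofReal (c / 2) < f x}.indicator f x ∂μ := by
  set F := {x | ENNReal.ofReal (c / 2) < f x}.indicator f with hF
  have hFm : Measurable F := hf.indicator (measurableSet_lt measurable_const hf)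
  have hle : ∀ x, f x ≤ F x + ENNReal.ofReal (c / 2) := by
    intro x
    by_cases hx : ENNReal.ofReal (c / 2) < f x
    · rw [hF, indicator_of_mem (by exact hx)]
      exact le_self_add
    · exact (not_lt.1 hx).trans le_add_self
  -- The part of `f` below `c / 2` contributes at most `c / 2` to any average, so the part above
  -- must supply the rest.
  have hsub : dyadicExceed f ω c ⊆ dyadicExceed F ω (c / 2) := by
    rintro x ⟨k, hk⟩
    refine ⟨k, ?_⟩
    have h1 : ∫⁻ s in Ioc (0 : ℝ) (2 ^ k), f (x + s • ω)
        ≤ (∫⁻ s in Ioc (0 : ℝ) (2 ^ k), F (x + s • ω)) + ENNReal.ofReal (c / 2 * 2 ^ k) := by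
      refine (lintegral_mono fun s => hle (x + s • ω)).trans_eq ?_
      rw [lintegral_add_right _ measurable_const, setLIntegral_const, Real.volume_Ioc, sub_zero,
        ← ENNReal.ofReal_mul (by positivity)]
    have h2 : ENNReal.ofReal (c * 2 ^ k)
        = ENNReal.ofReal (c / 2 * 2 ^ k) + ENNReal.ofReal (c / 2 * 2 ^ k) := by
      rw [← ENNReal.ofReal_add (by positivity) (by positivity)]
      congr 1
      ring
    rw [h2] at hk
    exact lt_of_add_lt_add_right (hk.trans_le h1)
  have h3 := mul_measure_dyadicExceed_le μ hFm ω (half_pos hc)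
  calc ENNReal.ofReal c * μ (dyadicExceed f ω c)
      ≤ (2 * ENNReal.ofReal (c / 2)) * μ (dyadicExceed F ω (c / 2)) := by
        gcongr
        rw [show (2 : ℝ≥0∞) = ENNReal.ofReal 2 by norm_num, ← ENNReal.ofReal_mul (by norm_num)]
        apply ENNReal.ofReal_le_ofReal
        linarith
    _ ≤ 2 * (20 * ∫⁻ x, F x ∂μ) := by
        rw [mul_assoc]
        gcongr
    _ = 40 * ∫⁻ x, F x ∂μ := by
        rw [← mul_assoc]
        norm_num

theorem setLIntegral_Ioi_rpow_neg {c q : ℝ} (hc : 0 < c) (hq : 1 < q) :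
    ∫⁻ h in Ioi c, ENNReal.ofReal (h ^ (-q)) = ENNReal.ofReal (c ^ (1 - q) / (q - 1)) := by
  rw [← ofReal_integral_eq_lintegral_ofReal (integrableOn_Ioi_rpow_of_lt (by linarith) hc),
    integral_Ioi_rpow_of_lt (by linarith) hc]
  · congr 1
    rw [show -q + 1 = -(q - 1) by ring, show 1 - q = -(q - 1) by ring, neg_div_neg_eq]
  · filter_upwards [ae_restrict_mem measurableSet_Ioi] with h hh
    exact Real.rpow_nonneg (hc.trans hh).le _

/-- The radial integral of the limit integrand, used with `a = |∇u(x)·ω|`. -/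
theorem setLIntegral_rpow_of_one_lt_mul {a q : ℝ} (ha : 0 ≤ a) (hq : 0 < q) :
    ∫⁻ h in Ioi (0 : ℝ), {h : ℝ | 1 < h * a}.indicator
      (fun h => ENNReal.ofReal (q * h ^ (-1 - q))) h = ENNReal.ofReal (a ^ q) := by
  rcases ha.eq_or_lt with rfl | ha
  · simp [Real.zero_rpow hq.ne', not_lt.2 zero_le_one]
  · rw [lintegral_indicator (measurableSet_lt measurable_const (by fun_prop)),
      Measure.restrict_restrict (measurableSet_lt measurable_const (by fun_prop))]
    have hset : {h : ℝ | 1 < h * a} ∩ Ioi 0 = Ioi a⁻¹ := by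
      ext h
      simp only [mem_inter_iff, mem_ofPred_eq, mem_Ioi]
      rw [inv_lt_iff_one_lt_mul₀ ha]
      exact ⟨fun h1 => h1.1, fun h1 => ⟨h1, pos_of_mul_pos_left (one_pos.trans h1) ha.le⟩⟩
    rw [hset]
    simp_rw [ENNReal.ofReal_mul hq.le]
    rw [lintegral_const_mul _ (by fun_prop), show -1 - q = -(1 + q) by ring,
      setLIntegral_Ioi_rpow_neg (inv_pos.2 ha) (by linarith), ← ENNReal.ofReal_mul hq.le,
      Real.inv_rpow ha.le, ← Real.rpow_neg ha.le]
    congr 1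
    rw [show -(1 - (1 + q)) = q by ring, add_sub_cancel_left, mul_div_cancel₀ _ hq.ne']

/-- The maximal inequality in the form needed for domination. -/
theorem lintegral_rpow_mul_measure_dyadicExceed_le {G : E → ℝ} (hG : Measurable G)
    (hG0 : ∀ x, 0 ≤ G x) (ω : E) {q : ℝ} (hq : 1 < q) :
    ∫⁻ h in Ioi (0 : ℝ), ENNReal.ofReal (h ^ (-1 - q)) *
        μ (dyadicExceed (fun x => ENNReal.ofReal (G x)) ω (1 / (2 * h))) ≤
      80 * ENNReal.ofReal (4 ^ (q - 1) / (q - 1)) * ∫⁻ x, ENNReal.ofReal (G x ^ q) ∂μ := by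
  set f : E → ℝ≥0∞ := fun x => ENNReal.ofReal (G x) with hf
  have hfm : Measurable f := by fun_prop
  have h1 : ∀ h ∈ Ioi (0 : ℝ), ENNReal.ofReal (h ^ (-1 - q)) *
        μ (dyadicExceed f ω (1 / (2 * h))) ≤
      80 * ∫⁻ x, {r : ℝ × E | 1 / (4 * r.1) < G r.2}.indicator
        (fun r => ENNReal.ofReal (r.1 ^ (-q)) * f r.2) (h, x) ∂μ := by
    intro h hh
    have hh : 0 < h := hh
    have h2 := mul_measure_dyadicExceed_le_indicator μ hfm ω (c := 1 / (2 * h)) (by positivity)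
    have h3 : ∀ x, {x | ENNReal.ofReal (1 / (2 * h) / 2) < f x}.indicator f x
        = {r : ℝ × E | 1 / (4 * r.1) < G r.2}.indicator (fun r => f r.2) (h, x) := by
      intro x
      have h3 : ENNReal.ofReal (1 / (2 * h) / 2) < f x ↔ 1 / (4 * h) < G x := by
        rw [hf, ENNReal.ofReal_lt_ofReal_iff_of_nonneg (by positivity),
          show 1 / (2 * h) / 2 = 1 / (4 * h) by field_simp; norm_num]
      simp only [indicator, mem_ofPred_eq, h3]
    simp_rw [h3] at h2
    have h4 : ∀ x, {r : ℝ × E | 1 / (4 * r.1) < G r.2}.indicator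
        (fun r => ENNReal.ofReal (r.1 ^ (-q)) * f r.2) (h, x) = ENNReal.ofReal (h ^ (-q)) *
        {r : ℝ × E | 1 / (4 * r.1) < G r.2}.indicator (fun r => f r.2) (h, x) := by
      intro x
      simp only [indicator]
      split_ifs <;> simp
    simp_rw [h4]
    rw [lintegral_const_mul' _ _ ENNReal.ofReal_ne_top]
    calc ENNReal.ofReal (h ^ (-1 - q)) * μ (dyadicExceed f ω (1 / (2 * h)))
        = ENNReal.ofReal (2 * h ^ (-q)) *
          (ENNReal.ofReal (1 / (2 * h)) * μ (dyadicExceed f ω (1 / (2 * h)))) := by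
          rw [← mul_assoc, ← ENNReal.ofReal_mul (by positivity)]
          congr 2
          rw [show -1 - q = -q - 1 by ring, Real.rpow_sub_one hh.ne']
          field_simp
      _ ≤ _ := mul_le_mul_right h2 _
      _ = _ := by
          rw [ENNReal.ofReal_mul (by norm_num), show (80 : ℝ≥0∞) = ENNReal.ofReal 2 * 40 by
            norm_num]
          ring
  have hset : MeasurableSet {r : ℝ × E | 1 / (4 * r.1) < G r.2} :=
    measurableSet_lt (by fun_prop) (by fun_prop)
  have hmeas : Measurable ({r : ℝ × E | 1 / (4 * r.1) < G r.2}.indicator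
        (fun r => ENNReal.ofReal (r.1 ^ (-q)) * f r.2)) := by
    refine Measurable.indicator ?_ hset
    fun_prop
  refine (setLIntegral_mono' measurableSet_Ioi h1).trans ?_
  -- After the exchange, the integral in `h` at fixed `x` runs over `h > 1 / (4 G x)`. It equals `(4
  -- G x)^(q-1) / (q-1)`, which with the factor `G x` produces `G x ^ q`.
  rw [lintegral_const_mul _ hmeas.lintegral_prod_right',
    lintegral_lintegral_swap (by exact hmeas.aemeasurable), mul_assoc,
    ← lintegral_const_mul' _ _ ENNReal.ofReal_ne_top]
  gcongr with x
  rcases (hG0 x).eq_or_lt with h0 | h0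
  · simp [indicator, hf, ← h0]
  have h5 : ∀ h ∈ Ioi (0 : ℝ), {r : ℝ × E | 1 / (4 * r.1) < G r.2}.indicator
        (fun r => ENNReal.ofReal (r.1 ^ (-q)) * f r.2) (h, x)
      ≤ (Ioi (1 / (4 * G x))).indicator (fun h => f x * ENNReal.ofReal (h ^ (-q))) h := by
    intro h hh
    have hh : 0 < h := hh
    by_cases hx : 1 / (4 * h) < G x
    · rw [indicator_of_mem (by exact hx), indicator_of_mem, mul_comm]
      rw [mem_Ioi]
      rw [div_lt_iff₀ (by positivity)] at hx ⊢
      linarith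
    · rw [indicator_of_notMem (by exact hx)]
      exact zero_le
  refine (setLIntegral_mono' measurableSet_Ioi h5).trans ?_
  refine (setLIntegral_le_lintegral _ _).trans ?_
  rw [lintegral_indicator measurableSet_Ioi, lintegral_const_mul' _ _ ENNReal.ofReal_ne_top,
    setLIntegral_Ioi_rpow_neg (by positivity) hq, ← ENNReal.ofReal_mul (hG0 x),
    ← ENNReal.ofReal_mul (by have := sub_pos.2 hq; positivity)]
  apply le_of_eq
  congr 1
  rw [one_div, Real.inv_rpow (by positivity), ← Real.rpow_neg (by positivity),
    show -(1 - q) = q - 1 by ring, Real.mul_rpow (by norm_num) h0.le]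
  have h6 : G x ^ q = G x * G x ^ (q - 1) := by
    rw [Real.rpow_sub_one h0.ne']
    field_simp
  rw [h6]
  ring

end VarExp

/-! ### Weak gradients along lines -/

namespace VarExp
open Set

section Line

variable {E : Type*} [NormedAddCommGroup E] [NormedSpace ℝ E] [MeasurableSpace E] [BorelSpace E]
  [SecondCountableTopology E] {μ : Measure E}

/-- The segments issued from a compact set sweep out a compact set, on which `f` is integrable. -/
theorem integrable_comp_add_smul [μ.IsAddHaarMeasure] [SFinite μ] {f : E → ℝ} (hfm : Measurable f) (hf : LocallyIntegrable f μ)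
    (w : E) {A : Set E} (hA : IsCompact A) :
    Integrable (fun q : E × ℝ => f (q.1 + q.2 • w))
      ((μ.restrict A).prod (volume.restrict (Ioc (0 : ℝ) 1))) := by
  have hm : Measurable fun q : E × ℝ => f (q.1 + q.2 • w) := by fun_prop
  refine ⟨hm.aestronglyMeasurable, ?_⟩
  rw [hasFiniteIntegral_def, lintegral_prod_symm' _ hm.enorm]
  set B : Set E := (fun q : E × ℝ => q.1 + q.2 • w) '' (A ×ˢ Icc (0 : ℝ) 1) with hB
  have hBc : IsCompact B := (hA.prod isCompact_Icc).image (by fun_prop)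
  have hfin : ∫⁻ x in B, ‖f x‖ₑ ∂μ < ∞ := (hf.integrableOn_isCompact hBc).2
  refine lt_of_le_of_lt (setLIntegral_mono' (g := fun _ => ∫⁻ x in B, ‖f x‖ₑ ∂μ)
    measurableSet_Ioc fun s hs => ?_) ?_
  · calc ∫⁻ x in A, ‖f (x + s • w)‖ₑ ∂μ
        ≤ ∫⁻ x in (fun x => x + s • w) ⁻¹' B, ‖f (x + s • w)‖ₑ ∂μ := by
          refine lintegral_mono_set fun x hx => ?_
          exact ⟨(x, s), ⟨hx, Ioc_subset_Icc_self hs⟩, rfl⟩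
      _ = ∫⁻ x in B, ‖f x‖ₑ ∂μ :=
          (measurePreserving_add_right μ (s • w)).setLIntegral_comp_preimage_emb
            (measurableEmbedding_addRight _) (fun x => ‖f x‖ₑ) B
  · simpa using hfin

/-- Lebesgue differentiation along almost every line, for a sequence of increments. -/
theorem ae_tendsto_integral_line [ProperSpace E] [μ.IsAddHaarMeasure] [SFinite μ]
    {f : E → ℝ} (hfm : Measurable f) (hf : LocallyIntegrable f μ)
    (w : E) {t : ℕ → ℝ} (ht : Tendsto t atTop (𝓝[≠] 0)) :
    ∀ᵐ x ∂μ, Tendsto (fun k => ∫ s in (0 : ℝ)..1, f (x + (s * t k) • w)) atTop (𝓝 (f x)) := by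
  set A : ℕ → E → ℝ := fun k x => ∫ s in (0 : ℝ)..1, f (x + (s * t k) • w)
  have hA : ∀ k, Measurable (A k) := by
    intro k
    have h1 : Measurable fun q : E × ℝ => f (q.1 + (q.2 * t k) • w) := by fun_prop
    simp only [A, intervalIntegral.integral_of_le (zero_le_one (α := ℝ))]
    exact h1.stronglyMeasurable.integral_prod_right'.measurable
  have hS : MeasurableSet {x | Tendsto (fun k => A k x) atTop (𝓝 (f x))} := by
    have h2 : {x | Tendsto (fun k => A k x) atTop (𝓝 (f x))}
        = {x | Tendsto (fun k => A k x - f x) atTop (𝓝 0)} := by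
      ext x
      exact tendsto_sub_nhds_zero_iff.symm
    rw [h2]
    exact measurableSet_tendsto _ fun k => (hA k).sub hfm
  set Z := {x | Tendsto (fun k => A k x) atTop (𝓝 (f x))}ᶜ with hZ
  change μ Z = 0
  -- The measure of `Z` is the double integral of its indicator along segments, so it suffices that
  -- almost every line meets `Z` in a null set. On a line, the averages are difference quotients of
  -- a primitive.
  have hfub := lintegral_setLIntegral_line μ (f := Z.indicator 1)
    (measurable_one.indicator hS.compl) w (Ioc 0 1)
  rw [lintegral_indicator_one hS.compl] at hfub
  simp only [Real.volume_Ioc, sub_zero, ENNReal.ofReal_one, one_mul] at hfub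
  rw [← hfub, lintegral_eq_zero_iff (by
    exact (measurable_setLIntegral_line (measurable_one.indicator hS.compl) _).comp
      (f := fun x : E => (x, w)) (by fun_prop))]
  have hint : ∀ᵐ x ∂μ, IntervalIntegrable (fun s => f (x + s • w)) volume 0 1 := by
    have h3 : ∀ N : ℕ, ∀ᵐ x ∂μ, x ∈ Metric.closedBall (0 : E) N →
        IntervalIntegrable (fun s => f (x + s • w)) volume 0 1 := by
      intro N
      have h4 := (integrable_comp_add_smul hfm hf w
        (isCompact_closedBall (0 : E) (N : ℝ))).prod_right_ae
      rw [ae_restrict_iff' Metric.isClosed_closedBall.measurableSet] at h4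
      filter_upwards [h4] with x hx hxN
      rw [intervalIntegrable_iff_integrableOn_Ioc_of_le zero_le_one]
      exact hx hxN
    filter_upwards [ae_all_iff.2 h3] with x hx
    obtain ⟨N, hN⟩ := exists_nat_ge ‖x‖
    exact hx N (by simpa using hN)
  filter_upwards [hint] with x hx
  simp only [Pi.zero_apply]
  rw [lintegral_eq_zero_iff (by
    exact (measurable_one.indicator hS.compl).comp (f := fun s : ℝ => x + s • w) (by fun_prop))]
  refine (ae_restrict_iff' measurableSet_Ioc).2 ?_
  filter_upwards [hx.ae_hasDerivAt_integral] with r hr hr01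
  rw [uIcc_of_le zero_le_one] at hr
  have hr2 := Ioc_subset_Icc_self hr01
  have h5 := (hasDerivAt_iff_tendsto_slope_zero.1 (hr hr2 r hr2)).comp ht
  simp only [Pi.zero_apply]
  refine indicator_of_notMem ?_ _
  rw [hZ, notMem_compl_iff]
  change Tendsto (fun k => A k (x + r • w)) atTop (𝓝 (f (x + r • w)))
  refine h5.congr' ?_
  filter_upwards [ht.eventually eventually_mem_nhdsWithin] with k hk
  have hk : t k ≠ 0 := hk
  have h6 := intervalIntegral.integral_comp_add_mul (a := 0) (b := 1)
    (fun s => f (x + s • w)) hk r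
  simp only [Function.comp_apply, intervalIntegral.integral_same, sub_zero, A]
  rw [mul_zero, add_zero, mul_one] at h6
  rw [← h6]
  refine intervalIntegral.integral_congr fun s _ => ?_
  simp only [add_smul, add_assoc, mul_comm]

theorem integrable_mul_comp_sub_smul {f ψ : E → ℝ} (hf : LocallyIntegrable f μ) (hψ : Continuous ψ) (hψc : HasCompactSupport ψ) (w : E) :
    Integrable (fun q : E × ℝ => f q.1 * ψ (q.1 - q.2 • w))
      (μ.prod (volume.restrict (Ioc (0 : ℝ) 1))) := by
  obtain ⟨C, hC⟩ := hψ.bounded_above_of_compact_support hψc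
  set B : Set E := (fun q : E × ℝ => q.1 + q.2 • w) '' (tsupport ψ ×ˢ Icc (0 : ℝ) 1) with hB
  have hBc : IsCompact B := (IsCompact.prod hψc isCompact_Icc).image (by fun_prop)
  have hi : Integrable (B.indicator f) μ :=
    (integrable_indicator_iff hBc.measurableSet).2 (hf.integrableOn_isCompact hBc)
  have h1 : Integrable (fun q : E × ℝ => B.indicator f q.1 * 1)
      (μ.prod (volume.restrict (Ioc (0 : ℝ) 1))) :=
    hi.mul_prod (g := fun _ : ℝ => (1 : ℝ)) (integrable_const _)
  have h2 := h1.mul_bdd (c := C) (g := fun q : E × ℝ => ψ (q.1 - q.2 • w))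
    (by fun_prop) (Eventually.of_forall fun q => hC _)
  refine h2.congr ?_
  have h3 : ∀ᵐ q : E × ℝ ∂μ.prod (volume.restrict (Ioc (0 : ℝ) 1)), q.2 ∈ Ioc (0 : ℝ) 1 := by
    refine (Measure.ae_prod_iff_ae_ae (measurableSet_Ioc.preimage measurable_snd)).2 ?_
    exact Eventually.of_forall fun x => ae_restrict_mem measurableSet_Ioc
  filter_upwards [h3] with q hq
  by_cases hqB : q.1 ∈ B
  · simp [indicator_of_mem hqB]
  · have : ψ (q.1 - q.2 • w) = 0 := by
      by_contra h0
      refine hqB ⟨(q.1 - q.2 • w, q.2), ⟨subset_tsupport _ h0, Ioc_subset_Icc_self hq⟩, ?_⟩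
      simp
    simp [this]

end Line

variable {n : ℕ} {u : EuclideanSpace ℝ (Fin n) → ℝ}
  {g g' : EuclideanSpace ℝ (Fin n) → EuclideanSpace ℝ (Fin n)}

theorem LocallyIntegrable.inner_const_right (hg : LocallyIntegrable g volume)
    (w : EuclideanSpace ℝ (Fin n)) : LocallyIntegrable (fun x => inner ℝ (g x) w) volume := by
  rw [locallyIntegrable_iff] at hg ⊢
  exact fun K hK => (hg K hK).inner_const w

/-- Lets the given gradient inherit the integrability of the possibly different ones provided by
`W^{1,p⁺}` and `W^{1,p⁻}`. -/
theorem HasWeakGradient.ae_unique (h : HasWeakGradient u g) (h' : HasWeakGradient u g') :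
    g =ᵐ[volume] g' := by
  have key : ∀ v : EuclideanSpace ℝ (Fin n), ∀ᵐ x, inner ℝ (g x) v = inner ℝ (g' x) v := by
    intro v
    refine ae_eq_of_integral_contDiff_smul_eq
      (LocallyIntegrable.inner_const_right h.locallyIntegrable_grad v)
      (LocallyIntegrable.inner_const_right h'.locallyIntegrable_grad v) fun φ hφ hφc => ?_
    have h1 := h.integral_eq φ hφ hφc v
    rw [h'.integral_eq φ hφ hφc v] at h1
    simpa using h1.symm
  filter_upwards [ae_all_iff.2 fun i : Fin n => key (EuclideanSpace.single i 1)] with x hx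
  ext i
  simpa [EuclideanSpace.inner_single_right] using hx i

/-- The weak gradient recovers the increments of the function along almost every segment. -/
theorem HasWeakGradient.ae_sub_eq_integral (h : HasWeakGradient u g)
    (hg : Measurable g) (w : EuclideanSpace ℝ (Fin n)) :
    ∀ᵐ x, u (x + w) - u x = ∫ s in (0 : ℝ)..1, inner ℝ (g (x + s • w)) w := by
  set f : EuclideanSpace ℝ (Fin n) → ℝ := fun x => inner ℝ (g x) w with hf
  have hfm : Measurable f := by fun_prop
  have hfl : LocallyIntegrable f volume :=
    LocallyIntegrable.inner_const_right h.locallyIntegrable_grad w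
  have hul : LocallyIntegrable (fun x => u (x + w)) volume := by
    have hmp := measurePreserving_add_right (volume : Measure (EuclideanSpace ℝ (Fin n))) w
    rw [locallyIntegrable_iff]
    intro K hK
    have hK' : IsCompact ((fun x => x + w) '' K) := hK.image (by fun_prop)
    have := (hmp.integrableOn_comp_preimage (measurableEmbedding_addRight w) (f := u)
      (s := (fun x => x + w) '' K)).2 (h.locallyIntegrable.integrableOn_isCompact hK')
    exact this.mono_set (subset_preimage_image _ _)
  have hGl : LocallyIntegrable (fun x => ∫ s in (0 : ℝ)..1, f (x + s • w)) volume := by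
    rw [locallyIntegrable_iff]
    intro K hK
    simp only [intervalIntegral.integral_of_le (zero_le_one (α := ℝ))]
    exact (integrable_comp_add_smul hfm hfl w hK).integral_prod_left
  refine ae_eq_of_integral_contDiff_smul_eq (hul.sub h.locallyIntegrable) hGl fun φ hφ hφc => ?_
  simp only [smul_eq_mul, intervalIntegral.integral_of_le (zero_le_one (α := ℝ))]
  obtain ⟨C, hC⟩ := hφ.continuous.bounded_above_of_compact_support hφc
  have hdiff : Differentiable ℝ φ := hφ.differentiable (by simp)
  have htrans : ∀ v, ContDiff ℝ (⊤ : ℕ∞) (fun x => φ (x - v)) ∧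
      HasCompactSupport (fun x => φ (x - v)) := by
    intro v
    refine ⟨hφ.comp (contDiff_id.sub contDiff_const), ?_⟩
    exact hφc.comp_homeomorph (Homeomorph.subRight v)
  have hfd : ∀ v x, fderiv ℝ (fun x => φ (x - v)) x w = fderiv ℝ φ (x - v) w := by
    intro v x
    rw [fderiv_comp_sub]
  set ψ : EuclideanSpace ℝ (Fin n) → ℝ := fun x => fderiv ℝ φ x w with hψ
  have hψcont : Continuous ψ := (hφ.continuous_fderiv (by simp)).clm_apply continuous_const
  have hψc : HasCompactSupport ψ := hφc.fderiv_apply (𝕜 := ℝ) w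
  have hint : Integrable (fun q : EuclideanSpace ℝ (Fin n) × ℝ => φ q.1 * f (q.1 + q.2 • w))
      (volume.prod (volume.restrict (Ioc (0 : ℝ) 1))) := by
    have h1 := (integrable_comp_add_smul hfm hfl w hφc).bdd_mul (c := C)
      (f := fun q : EuclideanSpace ℝ (Fin n) × ℝ => φ q.1)
      (by have := hφ.continuous; fun_prop) (Eventually.of_forall fun q => hC _)
    have h2 : (volume.restrict (tsupport φ)).prod (volume.restrict (Ioc (0 : ℝ) 1))
        = ((volume : Measure (EuclideanSpace ℝ (Fin n))).prod
            (volume.restrict (Ioc (0 : ℝ) 1))).restrict (tsupport φ ×ˢ univ) := by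
      rw [← Measure.prod_restrict, Measure.restrict_univ]
    rw [h2] at h1
    refine IntegrableOn.integrable_of_forall_notMem_eq_zero h1 fun q hq => ?_
    have : q.1 ∉ tsupport φ := fun h => hq ⟨h, mem_univ _⟩
    simp [image_eq_zero_of_notMem_tsupport this]
  have hshift : ∀ (a : EuclideanSpace ℝ (Fin n) → ℝ) (v : EuclideanSpace ℝ (Fin n)),
      ∫ x, φ x * a (x + v) = ∫ x, φ (x - v) * a x := by
    intro a v
    simpa using integral_add_right_eq_self (μ := volume) (fun x => φ (x - v) * a x) v
  have hftc : ∀ x, ∫ s in Ioc (0 : ℝ) 1, ψ (x - s • w) = φ x - φ (x - w) := by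
    intro x
    have hder : ∀ s ∈ uIcc (0 : ℝ) 1,
        HasDerivAt (fun s : ℝ => -φ (x - s • w)) (ψ (x - s • w)) s := by
      intro s _
      have h1 : HasDerivAt (fun s : ℝ => x - s • w) (-w) s := by
        simpa using ((hasDerivAt_id s).smul_const w).const_sub x
      have h2 := ((hdiff (x - s • w)).hasFDerivAt.comp_hasDerivAt s h1).neg
      simp only [map_neg, neg_neg] at h2
      exact h2
    rw [← intervalIntegral.integral_of_le zero_le_one,
      intervalIntegral.integral_eq_sub_of_hasDerivAt hder
        (Continuous.intervalIntegrable (by fun_prop) _ _)]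
    simp
    ring
  have hmulint : ∀ {a b : EuclideanSpace ℝ (Fin n) → ℝ}, LocallyIntegrable a volume →
      Continuous b → HasCompactSupport b → Integrable (fun x => b x * a x) volume := by
    intro a b ha hb hbc
    simpa using ha.integrable_smul_left_of_hasCompactSupport hb hbc
  -- The increment is moved onto the test function, where the classical fundamental theorem of
  -- calculus applies; the weak gradient identity is then used for each translate `φ (· - s • w)`.
  calc ∫ x, φ x * (u (x + w) - u x)
      = (∫ x, φ (x - w) * u x) - ∫ x, φ x * u x := by
        simp_rw [mul_sub]
        rw [integral_sub (hmulint hul hφ.continuous hφc)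
          (hmulint h.locallyIntegrable hφ.continuous hφc), hshift]
    _ = ∫ x, u x * (-∫ s in Ioc (0 : ℝ) 1, ψ (x - s • w)) := by
        rw [← integral_sub (hmulint h.locallyIntegrable (htrans w).1.continuous (htrans w).2)
          (hmulint h.locallyIntegrable hφ.continuous hφc)]
        refine integral_congr_ae (Eventually.of_forall fun x => ?_)
        simp only [hftc]
        ring
    _ = ∫ x, -∫ s in Ioc (0 : ℝ) 1, u x * ψ (x - s • w) := by
        refine integral_congr_ae (Eventually.of_forall fun x => ?_)
        simp only [integral_const_mul]
        ring
    _ = -∫ s in Ioc (0 : ℝ) 1, ∫ x, u x * ψ (x - s • w) := by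
        rw [integral_neg, integral_integral_swap]
        exact integrable_mul_comp_sub_smul h.locallyIntegrable hψcont hψc w
    _ = ∫ s in Ioc (0 : ℝ) 1, ∫ x, φ x * f (x + s • w) := by
        rw [← integral_neg]
        refine integral_congr_ae (Eventually.of_forall fun s => ?_)
        simp only
        rw [hshift f (s • w)]
        have h1 := h.integral_eq _ (htrans (s • w)).1 (htrans (s • w)).2 w
        simp only [hfd] at h1
        rw [h1, neg_neg]
    _ = ∫ x, φ x * ∫ s in Ioc (0 : ℝ) 1, f (x + s • w) := by
        rw [← integral_integral_swap (by exact hint)]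
        simp_rw [integral_const_mul]

/-- For a sequence, the increment formula holds at all `t k` simultaneously off one null set, and
turns each quotient into a line average. -/
theorem HasWeakGradient.ae_tendsto_div (h : HasWeakGradient u g)
    (hg : Measurable g) (w : EuclideanSpace ℝ (Fin n)) {t : ℕ → ℝ}
    (ht : Tendsto t atTop (𝓝[≠] 0)) :
    ∀ᵐ x, Tendsto (fun k => (u (x + t k • w) - u x) / t k) atTop (𝓝 (inner ℝ (g x) w)) := by
  have h1 := ae_tendsto_integral_line (f := fun x => inner ℝ (g x) w) (by fun_prop)
    (LocallyIntegrable.inner_const_right h.locallyIntegrable_grad w) w ht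
  have h2 := ae_all_iff.2 fun k => h.ae_sub_eq_integral hg (t k • w)
  filter_upwards [h1, h2] with x hx1 hx2
  refine hx1.congr' ?_
  filter_upwards [ht.eventually eventually_mem_nhdsWithin] with k hk
  have hk : t k ≠ 0 := hk
  rw [hx2 k, eq_div_iff hk, ← intervalIntegral.integral_mul_const]
  refine intervalIntegral.integral_congr fun s _ => ?_
  simp only [smul_smul, inner_smul_right]
  ring

theorem setLIntegral_Ioc_comp_mul (F : ℝ → ℝ≥0∞) {t : ℝ} (ht : 0 < t) :
    ∫⁻ s in Ioc (0 : ℝ) 1, ENNReal.ofReal t * F (s * t) = ∫⁻ s in Ioc (0 : ℝ) t, F s := by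
  have h := lintegral_image_eq_lintegral_abs_deriv_mul (s := Ioc (0 : ℝ) 1) (f := fun s => s * t)
    (f' := fun _ => t) measurableSet_Ioc
    (fun s _ => by simpa using ((hasDerivAt_id s).mul_const t).hasDerivWithinAt)
    (mul_left_injective₀ ht.ne').injOn F
  rw [image_mul_right_Ioc _ _ ht, zero_mul, one_mul, abs_of_pos ht] at h
  exact h.symm

theorem HasWeakGradient.ae_abs_sub_le (h : HasWeakGradient u g)
    (hg : Measurable g) {ω : EuclideanSpace ℝ (Fin n)} (hω : ‖ω‖ ≤ 1) {t : ℝ} (ht : 0 < t) :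
    ∀ᵐ x, ENNReal.ofReal |u (x + t • ω) - u x| ≤
      ∫⁻ s in Ioc (0 : ℝ) t, ENNReal.ofReal ‖g (x + s • ω)‖ := by
  filter_upwards [h.ae_sub_eq_integral hg (t • ω)] with x hx
  rw [hx, intervalIntegral.integral_of_le zero_le_one, ← Real.norm_eq_abs, ofReal_norm]
  refine (enorm_integral_le_lintegral_enorm _).trans ?_
  rw [← setLIntegral_Ioc_comp_mul _ ht]
  gcongr with s
  rw [← ofReal_norm, ← ENNReal.ofReal_mul ht.le]
  apply ENNReal.ofReal_le_ofReal
  rw [inner_smul_right, norm_mul, Real.norm_of_nonneg ht.le, smul_smul]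
  gcongr
  refine (norm_inner_le_norm _ _).trans ?_
  exact mul_le_of_le_one_right (norm_nonneg _) hω

end VarExp

/-! ### Polar coordinates and the constant `K` -/

namespace VarExp
open Set Metric
open scoped Pointwise

/-- Integration in polar coordinates. -/
theorem lintegral_eq_lintegral_sphere {E : Type*} [NormedAddCommGroup E] [NormedSpace ℝ E]
    [FiniteDimensional ℝ E] [Nontrivial E] [MeasurableSpace E] [BorelSpace E] (μ : Measure E)
    [μ.IsAddHaarMeasure] {Φ : E → ℝ≥0∞} (hΦ : Measurable Φ) :
    ∫⁻ x, Φ x ∂μ = ∫⁻ ω : sphere (0 : E) 1, (∫⁻ h in Ioi (0 : ℝ),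
      ENNReal.ofReal (h ^ (Module.finrank ℝ E - 1)) * Φ (h • (ω : E))) ∂μ.toSphere := by
  have h1 : ∫⁻ x, Φ x ∂μ = ∫⁻ z : ({0}ᶜ : Set E), Φ z ∂(μ.comap (↑)) := by
    rw [lintegral_subtype_comap (measurableSet_singleton _).compl, restrict_compl_singleton]
  have hmp := μ.measurePreserving_homeomorphUnitSphereProd
  have h2 : ∀ z : ({0}ᶜ : Set E), Φ z =
      (fun q : sphere (0 : E) 1 × Ioi (0 : ℝ) => Φ ((q.2 : ℝ) • (q.1 : E)))
        (homeomorphUnitSphereProd E z) := by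
    intro z
    have := congrArg (Subtype.val) ((homeomorphUnitSphereProd E).symm_apply_apply z)
    simp only [homeomorphUnitSphereProd_symm_apply_coe] at this
    simp only [this]
  have hm : Measurable fun q : sphere (0 : E) 1 × Ioi (0 : ℝ) => Φ ((q.2 : ℝ) • (q.1 : E)) := by
    fun_prop
  simp_rw [h1, h2]
  rw [hmp.lintegral_comp hm, lintegral_prod _ hm.aemeasurable]
  refine lintegral_congr fun ω => ?_
  rw [Measure.volumeIoiPow, lintegral_withDensity_eq_lintegral_mul _ (by fun_prop) (by fun_prop)]
  exact lintegral_subtype_comap measurableSet_Ioi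
    (fun h : ℝ => ENNReal.ofReal (h ^ (Module.finrank ℝ E - 1)) * Φ (h • (ω : E)))

/-- Surface measure is defined through the volume of cones, and a linear isometry commutes with
forming cones. -/
theorem measurePreserving_sphere_of_linearIsometryEquiv {E : Type*} [NormedAddCommGroup E]
    [NormedSpace ℝ E] [MeasurableSpace E] [BorelSpace E] {μ : Measure E}
    (L : E ≃ₗᵢ[ℝ] E) (hL : MeasurePreserving L μ μ) :
    MeasurePreserving (fun ω : sphere (0 : E) 1 => (⟨L ω, by simp⟩ : sphere (0 : E) 1))
      μ.toSphere μ.toSphere := by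
  have hm : Measurable (fun ω : sphere (0 : E) 1 => (⟨L ω, by simp⟩ : sphere (0 : E) 1)) :=
    (L.continuous.measurable.comp measurable_subtype_coe).subtype_mk
  refine ⟨hm, Measure.ext fun s hs => ?_⟩
  rw [Measure.map_apply hm hs, Measure.toSphere_apply' _ (hm hs), Measure.toSphere_apply' _ hs]
  congr 1
  have hset : Ioo (0 : ℝ) 1 • ((↑) '' ((fun ω : sphere (0 : E) 1 =>
      (⟨L ω, by simp⟩ : sphere (0 : E) 1)) ⁻¹' s) : Set E)
      = L ⁻¹' (Ioo (0 : ℝ) 1 • ((↑) '' s : Set E)) := by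
    ext x
    simp only [Set.mem_smul, mem_image, mem_preimage]
    constructor
    · rintro ⟨r, hr, _, ⟨ω, hω, rfl⟩, rfl⟩
      exact ⟨r, hr, L ω, ⟨_, hω, rfl⟩, by simp⟩
    · rintro ⟨r, hr, _, ⟨ω, hω, rfl⟩, h⟩
      refine ⟨r, hr, L.symm ω, ⟨⟨L.symm ω, by simp⟩, by simpa using hω, rfl⟩, ?_⟩
      apply L.injective
      simpa using h
  rw [hset]
  exact hL.measure_preimage_emb L.toHomeomorph.measurableEmbedding _

variable {n : ℕ}

theorem lintegral_sphere_abs_inner_rpow (v : EuclideanSpace ℝ (Fin n))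
    (e : sphere (0 : EuclideanSpace ℝ (Fin n)) 1) {q : ℝ} (hq : 0 < q) :
    ∫⁻ ω : sphere (0 : EuclideanSpace ℝ (Fin n)) 1, ENNReal.ofReal (|inner ℝ v ω| ^ q)
        ∂(volume : Measure (EuclideanSpace ℝ (Fin n))).toSphere
      = ENNReal.ofReal (q * K e q * ‖v‖ ^ q) := by
  set σ := (volume : Measure (EuclideanSpace ℝ (Fin n))).toSphere
  have hcont : Continuous fun ω : sphere (0 : EuclideanSpace ℝ (Fin n)) 1 =>
      |inner ℝ (ω : EuclideanSpace ℝ (Fin n)) (e : EuclideanSpace ℝ (Fin n))| ^ q :=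
    Continuous.rpow_const (by fun_prop) fun _ => Or.inr hq.le
  have hint : Integrable (fun ω : sphere (0 : EuclideanSpace ℝ (Fin n)) 1 =>
      |inner ℝ (ω : EuclideanSpace ℝ (Fin n)) (e : EuclideanSpace ℝ (Fin n))| ^ q) σ := by
    refine (integrable_const (1 : ℝ)).mono' hcont.aestronglyMeasurable
      (Eventually.of_forall fun ω => ?_)
    rw [Real.norm_of_nonneg (by positivity)]
    refine Real.rpow_le_one (abs_nonneg _) ?_ hq.le
    simpa using abs_real_inner_le_norm (ω : EuclideanSpace ℝ (Fin n))
      (e : EuclideanSpace ℝ (Fin n))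
  have hK : ENNReal.ofReal (q * K e q) = ∫⁻ ω : sphere (0 : EuclideanSpace ℝ (Fin n)) 1,
      ENNReal.ofReal (|inner ℝ (ω : EuclideanSpace ℝ (Fin n))
        (e : EuclideanSpace ℝ (Fin n))| ^ q) ∂σ := by
    rw [← ofReal_integral_eq_lintegral_ofReal hint
      (Eventually.of_forall fun ω => by positivity), K, ← mul_assoc, mul_one_div_cancel hq.ne',
      one_mul]
  rw [ENNReal.ofReal_mul' (by positivity), hK]
  rcases eq_or_ne v 0 with rfl | hv
  · simp [Real.zero_rpow hq.ne']
  have hv0 : ‖v‖ ≠ 0 := norm_ne_zero_iff.2 hv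
  set v' : EuclideanSpace ℝ (Fin n) := ‖v‖⁻¹ • v with hv'
  have hvv : v = ‖v‖ • v' := by rw [hv', smul_smul, mul_inv_cancel₀ hv0, one_smul]
  have hnorm : ‖(e : EuclideanSpace ℝ (Fin n))‖ = ‖v'‖ := by
    rw [hv', norm_smul, norm_inv, norm_norm, inv_mul_cancel₀ hv0]
    simp
  -- The reflection exchanging `e` and `v / ‖v‖` carries one spherical integral to the other.
  set R := (ℝ ∙ ((e : EuclideanSpace ℝ (Fin n)) - v'))ᗮ.reflection with hR
  have hRe : R e = v' := Submodule.reflection_sub hnorm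
  have hmp := measurePreserving_sphere_of_linearIsometryEquiv (μ := volume) R
    R.measurePreserving
  have hinner : ∀ ω : EuclideanSpace ℝ (Fin n), |inner ℝ v ω| ^ q
      = |inner ℝ (R ω) (e : EuclideanSpace ℝ (Fin n))| ^ q * ‖v‖ ^ q := by
    intro ω
    have h1 : inner ℝ v' ω = inner ℝ (R ω) (e : EuclideanSpace ℝ (Fin n)) := by
      rw [← hRe, ← R.inner_map_map, Submodule.reflection_reflection, real_inner_comm]
    nth_rewrite 1 [hvv]
    rw [real_inner_smul_left, abs_mul, abs_norm, h1,
      Real.mul_rpow (norm_nonneg _) (abs_nonneg _), mul_comm]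
  simp_rw [hinner]
  rw [← hmp.lintegral_comp (by fun_prop)]
  rw [← lintegral_mul_const' _ _ ENNReal.ofReal_ne_top]
  refine lintegral_congr fun ω => ?_
  rw [ENNReal.ofReal_mul (by positivity), hR, Submodule.reflection_reflection]

end VarExp

/-! ### Rescaling, domination and passage to the limit -/

namespace VarExp
open Set Metric

variable {n : ℕ}

/-- The integrand of the energy after rescaling and passing to polar coordinates. -/
noncomputable def rescaledIntegrand (p u : EuclideanSpace ℝ (Fin n) → ℝ) (δ : ℝ)
    (q : (sphere (0 : EuclideanSpace ℝ (Fin n)) 1 × ℝ) × EuclideanSpace ℝ (Fin n)) : ℝ≥0∞ :=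
  {q : (sphere (0 : EuclideanSpace ℝ (Fin n)) 1 × ℝ) × EuclideanSpace ℝ (Fin n) |
      δ < |u (q.2 + (δ * q.1.2) • (q.1.1 : EuclideanSpace ℝ (Fin n))) - u q.2|}.indicator
    (fun q => ENNReal.ofReal (p q.2 * q.1.2 ^ (-1 - p q.2))) q

/-- The product measure in polar coordinates. -/
noncomputable def polarMeasure (n : ℕ) :
    Measure ((sphere (0 : EuclideanSpace ℝ (Fin n)) 1 × ℝ) × EuclideanSpace ℝ (Fin n)) :=
  ((volume : Measure (EuclideanSpace ℝ (Fin n))).toSphere.prod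
    (volume.restrict (Ioi (0 : ℝ)))).prod volume

theorem measurable_rescaledIntegrand {p u : EuclideanSpace ℝ (Fin n) → ℝ} (hp : Measurable p)
    (hu : Measurable u) (δ : ℝ) : Measurable (rescaledIntegrand p u δ) := by
  refine Measurable.indicator (by fun_prop) (measurableSet_lt measurable_const ?_)
  have : Measurable fun q : (sphere (0 : EuclideanSpace ℝ (Fin n)) 1 × ℝ) ×
      EuclideanSpace ℝ (Fin n) =>
      u (q.2 + (δ * q.1.2) • (q.1.1 : EuclideanSpace ℝ (Fin n))) := hu.comp (by fun_prop)
  exact (this.sub (by fun_prop)).abs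

theorem lintegral_polarMeasure {F : (sphere (0 : EuclideanSpace ℝ (Fin n)) 1 × ℝ) ×
    EuclideanSpace ℝ (Fin n) → ℝ≥0∞} (hF : Measurable F) :
    ∫⁻ q, F q ∂(polarMeasure n) = ∫⁻ x, ∫⁻ ω, (∫⁻ h in Ioi (0 : ℝ), F ((ω, h), x))
      ∂(volume : Measure (EuclideanSpace ℝ (Fin n))).toSphere := by
  rw [polarMeasure, lintegral_prod_symm' _ hF]
  refine lintegral_congr fun x => ?_
  rw [lintegral_prod _ (by fun_prop)]

theorem setLIntegral_Ioi_comp_mul (F : ℝ → ℝ≥0∞) {t : ℝ} (ht : 0 < t) :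
    ∫⁻ s in Ioi (0 : ℝ), ENNReal.ofReal t * F (s * t) = ∫⁻ s in Ioi (0 : ℝ), F s := by
  have h := lintegral_image_eq_lintegral_abs_deriv_mul (s := Ioi (0 : ℝ)) (f := fun s => s * t)
    (f' := fun _ => t) measurableSet_Ioi
    (fun s _ => by simpa using ((hasDerivAt_id s).mul_const t).hasDerivWithinAt)
    (mul_left_injective₀ ht.ne').injOn F
  have himage : (fun s => s * t) '' Ioi 0 = Ioi 0 := by
    simpa using (OrderIso.mulRight₀ t ht).image_Ioi 0
  rw [himage, abs_of_pos ht] at h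
  exact h.symm

theorem nonlocalEnergy_eq_lintegral_polarMeasure (hn : 1 ≤ n)
    {p u : EuclideanSpace ℝ (Fin n) → ℝ} (hp : Measurable p) (hu : Measurable u) {δ : ℝ}
    (hδ : 0 < δ) :
    nonlocalEnergy p u δ = ∫⁻ q, rescaledIntegrand p u δ q ∂(polarMeasure n) := by
  have : Nonempty (Fin n) := ⟨⟨0, hn⟩⟩
  rw [lintegral_polarMeasure (measurable_rescaledIntegrand hp hu δ)]
  set Ψ : EuclideanSpace ℝ (Fin n) × EuclideanSpace ℝ (Fin n) → ℝ≥0∞ :=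
    {q | δ < |u q.1 - u q.2|}.indicator (fun q => ENNReal.ofReal
      (p q.1 * δ ^ p q.1 / ‖q.1 - q.2‖ ^ ((n : ℝ) + p q.1))) with hΨ
  have hset : MeasurableSet {q : EuclideanSpace ℝ (Fin n) × EuclideanSpace ℝ (Fin n) |
      δ < |u q.1 - u q.2|} := measurableSet_lt measurable_const (by fun_prop)
  have hΨm : Measurable Ψ := Measurable.indicator (by fun_prop) hset
  have h1 : nonlocalEnergy p u δ = ∫⁻ y, ∫⁻ x, Ψ (x, y) := by
    refine lintegral_congr fun y => ?_
    have hy : MeasurableSet {x | δ < |u x - u y|} := measurableSet_lt measurable_const (by fun_prop)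
    rw [← lintegral_indicator hy]
    rfl
  rw [h1, lintegral_lintegral_swap (by exact (hΨm.comp measurable_swap).aemeasurable)]
  refine lintegral_congr fun x => ?_
  have h2 : ∫⁻ y, Ψ (x, y) = ∫⁻ z, Ψ (x, x + z) :=
    (lintegral_add_left_eq_self (μ := volume) (fun y => Ψ (x, y)) x).symm
  rw [h2, lintegral_eq_lintegral_sphere _ (by fun_prop), finrank_euclideanSpace_fin]
  refine lintegral_congr fun ω => ?_
  -- Replacing the radius by `δ h` leaves `δ (δh)^(n-1) δ^p / (δh)^(n+p) = h^(-1-p)`.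
  rw [← setLIntegral_Ioi_comp_mul _ hδ]
  refine setLIntegral_congr_fun measurableSet_Ioi fun h hh => ?_
  have hh : 0 < h := hh
  have hω : ‖(ω : EuclideanSpace ℝ (Fin n))‖ = 1 := by simp
  simp only [hΨ, rescaledIntegrand, indicator, mem_ofPred_eq]
  rw [abs_sub_comm, mul_comm h δ]
  split_ifs
  · rw [← ENNReal.ofReal_mul (by positivity), ← ENNReal.ofReal_mul hδ.le]
    congr 1
    have h3 : ‖x - (x + (δ * h) • (ω : EuclideanSpace ℝ (Fin n)))‖ = δ * h := by
      rw [sub_add_cancel_left, norm_neg, norm_smul, hω, mul_one,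
        Real.norm_of_nonneg (by positivity)]
    have h4 : (δ * h) ^ (n - 1) = (δ * h) ^ ((n : ℝ) - 1) := by
      rw [← Real.rpow_natCast, Nat.cast_sub hn, Nat.cast_one]
    rw [h3, h4, Real.mul_rpow hδ.le hh.le, Real.mul_rpow hδ.le hh.le, Real.rpow_sub hδ,
      Real.rpow_sub hh, Real.rpow_add hδ, Real.rpow_add hh, Real.rpow_sub hh, Real.rpow_one,
      Real.rpow_one, Real.rpow_neg_one]
    field_simp
  · simp

/-- A function dominating all the rescaled integrands. -/
noncomputable def dominatingFunction (p : EuclideanSpace ℝ (Fin n) → ℝ)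
    (g : EuclideanSpace ℝ (Fin n) → EuclideanSpace ℝ (Fin n))
    (q : (sphere (0 : EuclideanSpace ℝ (Fin n)) 1 × ℝ) × EuclideanSpace ℝ (Fin n)) : ℝ≥0∞ :=
  {q : (sphere (0 : EuclideanSpace ℝ (Fin n)) 1 × ℝ) × EuclideanSpace ℝ (Fin n) |
      q.2 ∈ dyadicExceed (fun x => ENNReal.ofReal ‖g x‖) (q.1.1 : EuclideanSpace ℝ (Fin n))
        (1 / (2 * q.1.2))}.indicator
    (fun q => ENNReal.ofReal (p q.2 * q.1.2 ^ (-1 - p q.2))) q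

/-- The pointwise limit of the rescaled integrands. -/
noncomputable def limitIntegrand (p : EuclideanSpace ℝ (Fin n) → ℝ)
    (g : EuclideanSpace ℝ (Fin n) → EuclideanSpace ℝ (Fin n))
    (q : (sphere (0 : EuclideanSpace ℝ (Fin n)) 1 × ℝ) × EuclideanSpace ℝ (Fin n)) : ℝ≥0∞ :=
  {q : (sphere (0 : EuclideanSpace ℝ (Fin n)) 1 × ℝ) × EuclideanSpace ℝ (Fin n) |
      1 < q.1.2 * |inner ℝ (g q.2) (q.1.1 : EuclideanSpace ℝ (Fin n))|}.indicator
    (fun q => ENNReal.ofReal (p q.2 * q.1.2 ^ (-1 - p q.2))) q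

variable {p u : EuclideanSpace ℝ (Fin n) → ℝ}
  {g : EuclideanSpace ℝ (Fin n) → EuclideanSpace ℝ (Fin n)}

theorem measurable_dominatingFunction (hp : Measurable p) (hg : Measurable g) :
    Measurable (dominatingFunction p g) := by
  refine Measurable.indicator (by fun_prop) ?_
  exact (measurableSet_dyadicExceed (f := fun x => ENNReal.ofReal ‖g x‖) (by fun_prop)).preimage
    (f := fun q : (sphere (0 : EuclideanSpace ℝ (Fin n)) 1 × ℝ) × EuclideanSpace ℝ (Fin n) =>
      (((q.1.1 : EuclideanSpace ℝ (Fin n)), 1 / (2 * q.1.2)), q.2)) (by fun_prop)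

theorem measurable_limitIntegrand (hp : Measurable p) (hg : Measurable g) :
    Measurable (limitIntegrand p g) :=
  Measurable.indicator (by fun_prop) (measurableSet_lt measurable_const (by fun_prop))

/-- The line results hold for almost every `x` with `ω` and `h` fixed; measurability of the set lets
Fubini assemble them. -/
theorem ae_polarMeasure_of_forall {P : (sphere (0 : EuclideanSpace ℝ (Fin n)) 1 × ℝ) ×
    EuclideanSpace ℝ (Fin n) → Prop} (hP : MeasurableSet {q | P q})
    (h : ∀ (ω : sphere (0 : EuclideanSpace ℝ (Fin n)) 1) (h : ℝ), 0 < h →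
      ∀ᵐ x, P ((ω, h), x)) : ∀ᵐ q ∂(polarMeasure n), P q := by
  refine (Measure.ae_prod_iff_ae_ae hP).2 ?_
  have : ∀ᵐ q : sphere (0 : EuclideanSpace ℝ (Fin n)) 1 × ℝ
      ∂((volume : Measure (EuclideanSpace ℝ (Fin n))).toSphere.prod
        (volume.restrict (Ioi (0 : ℝ)))), q.2 ∈ Ioi (0 : ℝ) :=
    (Measure.ae_prod_iff_ae_ae (measurableSet_Ioi.preimage measurable_snd)).2
      (Eventually.of_forall fun ω => ae_restrict_mem measurableSet_Ioi)
  filter_upwards [this] with q hq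
  exact h q.1 q.2 hq

theorem rescaledIntegrand_ae_le (hp : Measurable p) (hu : Measurable u) (hg : Measurable g)
    (hw : HasWeakGradient u g) {δ : ℝ} (hδ : 0 < δ) :
    ∀ᵐ q ∂(polarMeasure n), rescaledIntegrand p u δ q ≤ dominatingFunction p g q := by
  refine ae_polarMeasure_of_forall (measurableSet_le (measurable_rescaledIntegrand hp hu δ)
    (measurable_dominatingFunction hp hg)) fun ω h hh => ?_
  filter_upwards [hw.ae_abs_sub_le hg (ω := ω) (by simp) (mul_pos hδ hh)] with x hx
  by_cases hq : δ < |u (x + (δ * h) • (ω : EuclideanSpace ℝ (Fin n))) - u x|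
  · have hmem : x ∈ dyadicExceed (fun x => ENNReal.ofReal ‖g x‖)
        (ω : EuclideanSpace ℝ (Fin n)) (1 / (2 * h)) := by
      -- With `2^k < δh ≤ 2^(k+1)`, passing to the dyadic length `2^(k+1)` less than doubles the
      -- segment, which accounts for the 2 in `1 / (2 * h)`.
      obtain ⟨k, hk1, hk2⟩ := exists_mem_Ioc_zpow (mul_pos hδ hh) (one_lt_two (α := ℝ))
      refine ⟨k + 1, ?_⟩
      calc ENNReal.ofReal (1 / (2 * h) * 2 ^ (k + 1)) ≤ ENNReal.ofReal δ := by
            apply ENNReal.ofReal_le_ofReal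
            rw [zpow_add_one₀ (by norm_num)]
            field_simp
            linarith
        _ < ENNReal.ofReal |u (x + (δ * h) • (ω : EuclideanSpace ℝ (Fin n))) - u x| :=
            (ENNReal.ofReal_lt_ofReal_iff (hδ.trans hq)).2 hq
        _ ≤ _ := hx
        _ ≤ _ := lintegral_mono_set (Ioc_subset_Ioc_right hk2)
    rw [rescaledIntegrand, dominatingFunction, indicator_of_mem (by exact hq),
      indicator_of_mem (by exact hmem)]
  · rw [rescaledIntegrand, indicator_of_notMem (by exact hq)]
    exact zero_le

/-- The smallest exponent dominates for `h ≥ 1`, the largest for `h ≤ 1`. -/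
theorem mul_rpow_le_of_mem_Icc {a b r h : ℝ} (ha : 0 < a) (har : a ≤ r) (hrb : r ≤ b)
    (hh : 0 < h) : r * h ^ (-1 - r) ≤ b * (h ^ (-1 - a) + h ^ (-1 - b)) := by
  have h1 : h ^ (-1 - r) ≤ h ^ (-1 - a) + h ^ (-1 - b) := by
    rcases le_total 1 h with h1 | h1
    · exact (Real.rpow_le_rpow_of_exponent_le h1 (by linarith)).trans
        (le_add_of_nonneg_right (by positivity))
    · exact (Real.rpow_le_rpow_of_exponent_ge hh h1 (by linarith)).trans
        (le_add_of_nonneg_left (by positivity))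
  exact mul_le_mul hrb h1 (by positivity) (by linarith)

theorem lintegral_dominatingFunction_lt_top (hp : Measurable p) (hg : Measurable g) {a b : ℝ}
    (ha : 1 < a) (hpa : ∀ x, a ≤ p x) (hpb : ∀ x, p x ≤ b)
    (hga : ∫⁻ x, ENNReal.ofReal (‖g x‖ ^ a) < ∞) (hgb : ∫⁻ x, ENNReal.ofReal (‖g x‖ ^ b) < ∞) :
    ∫⁻ q, dominatingFunction p g q ∂(polarMeasure n) < ∞ := by
  have hab : a ≤ b := (hpa 0).trans (hpb 0)
  have hb : 1 < b := ha.trans_le hab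
  have hm := measurable_dominatingFunction hp hg
  set M : ℝ≥0∞ := ENNReal.ofReal b *
    (80 * ENNReal.ofReal (4 ^ (a - 1) / (a - 1)) * (∫⁻ x, ENNReal.ofReal (‖g x‖ ^ a)) +
      80 * ENNReal.ofReal (4 ^ (b - 1) / (b - 1)) * ∫⁻ x, ENNReal.ofReal (‖g x‖ ^ b)) with hM
  have hMfin : M < ∞ := by
    refine ENNReal.mul_lt_top ENNReal.ofReal_lt_top (ENNReal.add_lt_top.2 ⟨?_, ?_⟩)
    · exact ENNReal.mul_lt_top (ENNReal.mul_lt_top (by simp) ENNReal.ofReal_lt_top) hga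
    · exact ENNReal.mul_lt_top (ENNReal.mul_lt_top (by simp) ENNReal.ofReal_lt_top) hgb
  rw [polarMeasure, lintegral_prod _ hm.aemeasurable, lintegral_prod _ (by
    exact hm.lintegral_prod_right'.aemeasurable)]
  refine lt_of_le_of_lt (lintegral_mono (g := fun _ => M) fun ω => ?_) ?_
  · set S : ℝ → Set (EuclideanSpace ℝ (Fin n)) := fun h =>
      dyadicExceed (fun x => ENNReal.ofReal ‖g x‖) (ω : EuclideanSpace ℝ (Fin n)) (1 / (2 * h))
      with hS
    have hSm : MeasurableSet {r : ℝ × EuclideanSpace ℝ (Fin n) | r.2 ∈ S r.1} := by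
      have h1 : Measurable fun r : ℝ × EuclideanSpace ℝ (Fin n) =>
          (((ω : EuclideanSpace ℝ (Fin n)), 1 / (2 * r.1)), r.2) := by fun_prop
      exact h1 (measurableSet_dyadicExceed (f := fun x => ENNReal.ofReal ‖g x‖) (by fun_prop))
    have hSh : ∀ h, MeasurableSet (S h) := fun h => measurable_prodMk_left hSm
    have hvol : Measurable fun h => volume (S h) := measurable_measure_prodMk_left hSm
    have hbound : ∀ h ∈ Ioi (0 : ℝ), ∫⁻ x, dominatingFunction p g ((ω, h), x) ≤
        ENNReal.ofReal b * (ENNReal.ofReal (h ^ (-1 - a)) * volume (S h) +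
          ENNReal.ofReal (h ^ (-1 - b)) * volume (S h)) := by
      intro h hh
      have hh : 0 < h := hh
      calc ∫⁻ x, dominatingFunction p g ((ω, h), x)
          ≤ ∫⁻ x, (S h).indicator
              (fun _ => ENNReal.ofReal (b * (h ^ (-1 - a) + h ^ (-1 - b)))) x := by
            refine lintegral_mono fun x => ?_
            by_cases hx : x ∈ S h
            · rw [dominatingFunction, indicator_of_mem (by exact hx), indicator_of_mem hx]
              exact ENNReal.ofReal_le_ofReal
                (mul_rpow_le_of_mem_Icc (by linarith) (hpa x) (hpb x) hh)
            · rw [dominatingFunction, indicator_of_notMem (by exact hx)]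
              exact zero_le
        _ = _ := by
            rw [lintegral_indicator_const (hSh h), ENNReal.ofReal_mul (by linarith),
              ENNReal.ofReal_add (by positivity) (by positivity)]
            ring
    refine (setLIntegral_mono' measurableSet_Ioi hbound).trans ?_
    rw [lintegral_const_mul' _ _ ENNReal.ofReal_ne_top, lintegral_add_left (by fun_prop)]
    simp only [hM]
    gcongr
    · exact lintegral_rpow_mul_measure_dyadicExceed_le volume hg.norm (fun x => norm_nonneg _)
        (ω : EuclideanSpace ℝ (Fin n)) ha
    · exact lintegral_rpow_mul_measure_dyadicExceed_le volume hg.norm (fun x => norm_nonneg _)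
        (ω : EuclideanSpace ℝ (Fin n)) hb
  · rw [lintegral_const]
    exact ENNReal.mul_lt_top hMfin (measure_lt_top _ _)

theorem lintegral_limitIntegrand (hp : Measurable p) (hg : Measurable g) (hp0 : ∀ x, 0 < p x)
    (e : sphere (0 : EuclideanSpace ℝ (Fin n)) 1) :
    ∫⁻ q, limitIntegrand p g q ∂(polarMeasure n)
      = ∫⁻ x, ENNReal.ofReal (p x * K e (p x) * ‖g x‖ ^ p x) := by
  rw [lintegral_polarMeasure (measurable_limitIntegrand hp hg)]
  refine lintegral_congr fun x => ?_
  rw [← lintegral_sphere_abs_inner_rpow (g x) e (hp0 x)]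
  refine lintegral_congr fun ω => ?_
  rw [← setLIntegral_rpow_of_one_lt_mul (abs_nonneg _) (hp0 x)]
  rfl

/-- Excludes the boundary of the limit region, where the indicators need not converge; for fixed `x`
and `ω` it holds at most one `h`. -/
theorem ae_mul_abs_inner_ne_one (hg : Measurable g) :
    ∀ᵐ q ∂(polarMeasure n),
      q.1.2 * |inner ℝ (g q.2) (q.1.1 : EuclideanSpace ℝ (Fin n))| ≠ 1 := by
  have hm : Measurable fun q : (sphere (0 : EuclideanSpace ℝ (Fin n)) 1 × ℝ) ×
      EuclideanSpace ℝ (Fin n) =>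
      q.1.2 * |inner ℝ (g q.2) (q.1.1 : EuclideanSpace ℝ (Fin n))| := by fun_prop
  have hset : MeasurableSet {q : (sphere (0 : EuclideanSpace ℝ (Fin n)) 1 × ℝ) ×
      EuclideanSpace ℝ (Fin n) |
      q.1.2 * |inner ℝ (g q.2) (q.1.1 : EuclideanSpace ℝ (Fin n))| = 1} :=
    hm (measurableSet_singleton 1)
  rw [ae_iff]
  simp only [not_not]
  rw [← lintegral_indicator_one hset, lintegral_polarMeasure (measurable_one.indicator hset)]
  refine lintegral_eq_zero_of_ae_eq_zero (Eventually.of_forall fun x => ?_)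
  refine lintegral_eq_zero_of_ae_eq_zero (Eventually.of_forall fun ω => ?_)
  refine lintegral_eq_zero_of_ae_eq_zero ?_
  set c := |inner ℝ (g x) (ω : EuclideanSpace ℝ (Fin n))| with hc
  have hae : ∀ᵐ h ∂(volume.restrict (Ioi (0 : ℝ))), h ≠ c⁻¹ :=
    ae_restrict_of_ae (by simp [ae_iff])
  filter_upwards [hae] with h hh
  refine indicator_of_notMem (fun h1 => hh ?_) _
  exact eq_inv_of_mul_eq_one_left h1

theorem tendsto_rescaledIntegrand {t : ℕ → ℝ} (ht : Tendsto t atTop (𝓝[>] 0))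
    {ω : sphere (0 : EuclideanSpace ℝ (Fin n)) 1} {h : ℝ} (hh : 0 < h)
    {x : EuclideanSpace ℝ (Fin n)}
    (hne : h * |inner ℝ (g x) (ω : EuclideanSpace ℝ (Fin n))| ≠ 1)
    (hx : Tendsto (fun k => (u (x + t k • h • (ω : EuclideanSpace ℝ (Fin n))) - u x) / t k) atTop
      (𝓝 (inner ℝ (g x) (h • (ω : EuclideanSpace ℝ (Fin n)))))) :
    Tendsto (fun k => rescaledIntegrand p u (t k) ((ω, h), x)) atTop
      (𝓝 (limitIntegrand p g ((ω, h), x))) := by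
  have hpos : ∀ᶠ k in atTop, 0 < t k := ht.eventually eventually_mem_nhdsWithin
  have habs := hx.abs
  rw [inner_smul_right, abs_mul, abs_of_pos hh] at habs
  refine tendsto_const_nhds.congr' ?_
  have hiff : ∀ k, 0 < t k →
      (t k < |u (x + (t k * h) • (ω : EuclideanSpace ℝ (Fin n))) - u x| ↔
        1 < |(u (x + t k • h • (ω : EuclideanSpace ℝ (Fin n))) - u x) / t k|) := by
    intro k hk
    rw [abs_div, abs_of_pos hk, one_lt_div hk, smul_smul]
  rcases lt_or_gt_of_ne hne with h1 | h1
  · filter_upwards [hpos, habs.eventually (gt_mem_nhds h1)] with k hk hk1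
    rw [limitIntegrand, rescaledIntegrand, indicator_of_notMem (by exact not_lt.2 h1.le),
      indicator_of_notMem]
    exact fun h2 => lt_asymm hk1 ((hiff k hk).1 h2)
  · filter_upwards [hpos, habs.eventually (lt_mem_nhds h1)] with k hk hk1
    rw [limitIntegrand, rescaledIntegrand, indicator_of_mem (by exact h1), indicator_of_mem]
    exact (hiff k hk).2 hk1

theorem ae_tendsto_rescaledIntegrand (hu : Measurable u) (hg : Measurable g)
    (hw : HasWeakGradient u g) {t : ℕ → ℝ} (ht : Tendsto t atTop (𝓝[>] 0)) :
    ∀ᵐ q ∂(polarMeasure n), Tendsto (fun k => rescaledIntegrand p u (t k) q) atTop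
      (𝓝 (limitIntegrand p g q)) := by
  have hset : MeasurableSet {q : (sphere (0 : EuclideanSpace ℝ (Fin n)) 1 × ℝ) ×
      EuclideanSpace ℝ (Fin n) | 0 < q.1.2 ∧
      Tendsto (fun k => (u (q.2 + t k • q.1.2 • (q.1.1 : EuclideanSpace ℝ (Fin n))) - u q.2) / t k
        - inner ℝ (g q.2) (q.1.2 • (q.1.1 : EuclideanSpace ℝ (Fin n)))) atTop (𝓝 0)} := by
    have h0 : MeasurableSet {q : (sphere (0 : EuclideanSpace ℝ (Fin n)) 1 × ℝ) ×
        EuclideanSpace ℝ (Fin n) | 0 < q.1.2} := measurableSet_lt measurable_const (by fun_prop)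
    refine h0.inter (measurableSet_tendsto _ fun k => ?_)
    have h1 : Measurable fun q : (sphere (0 : EuclideanSpace ℝ (Fin n)) 1 × ℝ) ×
        EuclideanSpace ℝ (Fin n) =>
        u (q.2 + t k • q.1.2 • (q.1.1 : EuclideanSpace ℝ (Fin n))) := hu.comp (by fun_prop)
    fun_prop
  have hlim := ae_polarMeasure_of_forall hset fun ω h hh => by
    filter_upwards [hw.ae_tendsto_div hg (h • (ω : EuclideanSpace ℝ (Fin n)))
      (ht.mono_right (nhdsWithin_mono _ fun _ h => ne_of_gt h))] with x hx
    exact ⟨hh, tendsto_sub_nhds_zero_iff.2 hx⟩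
  filter_upwards [hlim, ae_mul_abs_inner_ne_one hg] with q hq hne
  exact tendsto_rescaledIntegrand ht hq.1 hne (tendsto_sub_nhds_zero_iff.1 hq.2)

/-- The limit formula for measurable data and an exponent bounded between `a > 1` and `b`. -/
theorem tendsto_nonlocalEnergy (hn : 1 ≤ n) (hp : Measurable p) (hu : Measurable u)
    (hg : Measurable g) (hw : HasWeakGradient u g) {a b : ℝ} (ha : 1 < a)
    (hpa : ∀ x, a ≤ p x) (hpb : ∀ x, p x ≤ b)
    (hga : ∫⁻ x, ENNReal.ofReal (‖g x‖ ^ a) < ∞) (hgb : ∫⁻ x, ENNReal.ofReal (‖g x‖ ^ b) < ∞)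
    (e : sphere (0 : EuclideanSpace ℝ (Fin n)) 1) :
    Tendsto (fun δ : ℝ => nonlocalEnergy p u δ) (𝓝[>] 0)
        (𝓝 (∫⁻ x, ENNReal.ofReal (p x * K e (p x) * ‖g x‖ ^ p x))) ∧
      (∫⁻ x, ENNReal.ofReal (p x * K e (p x) * ‖g x‖ ^ p x)) < ∞ := by
  rw [← lintegral_limitIntegrand hp hg (fun x => by linarith [hpa x]) e]
  have hfin := lintegral_dominatingFunction_lt_top hp hg ha hpa hpb hga hgb
  have hseq : ∀ t : ℕ → ℝ, Tendsto t atTop (𝓝[>] 0) →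
      Tendsto (fun k => nonlocalEnergy p u (t k)) atTop
        (𝓝 (∫⁻ q, limitIntegrand p g q ∂(polarMeasure n))) := by
    intro t ht
    have hpos : ∀ᶠ k in atTop, 0 < t k := ht.eventually eventually_mem_nhdsWithin
    have h1 := tendsto_lintegral_filter_of_dominated_convergence (μ := polarMeasure n)
      (F := fun k => rescaledIntegrand p u (t k)) (dominatingFunction p g)
      (Eventually.of_forall fun k => measurable_rescaledIntegrand hp hu (t k))
      (hpos.mono fun k hk => rescaledIntegrand_ae_le hp hu hg hw hk) hfin.ne
      (ae_tendsto_rescaledIntegrand hu hg hw ht)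
    refine h1.congr' ?_
    filter_upwards [hpos] with k hk
    exact (nonlocalEnergy_eq_lintegral_polarMeasure hn hp hu hk).symm
  refine ⟨tendsto_of_seq_tendsto hseq, lt_of_le_of_lt (lintegral_mono_ae ?_) hfin⟩
  -- Finiteness: along one concrete sequence the domination passes to the pointwise limit.
  have ht : Tendsto (fun k : ℕ => 1 / ((k : ℝ) + 1)) atTop (𝓝[>] 0) :=
    tendsto_nhdsWithin_iff.2 ⟨tendsto_one_div_add_atTop_nhds_zero_nat,
      Eventually.of_forall fun k => by simp only [mem_Ioi]; positivity⟩
  filter_upwards [ae_tendsto_rescaledIntegrand (p := p) hu hg hw ht,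
    ae_all_iff.2 fun k : ℕ => rescaledIntegrand_ae_le hp hu hg hw
      (δ := 1 / ((k : ℝ) + 1)) (by positivity)] with q hq1 hq2
  exact le_of_tendsto' hq1 hq2

end VarExp

/-! ### Choice of representatives and conclusion -/

namespace VarExp

variable {n : ℕ} {p p' u u' : EuclideanSpace ℝ (Fin n) → ℝ}
  {g g' : EuclideanSpace ℝ (Fin n) → EuclideanSpace ℝ (Fin n)}

theorem HasWeakGradient.congr_ae (h : HasWeakGradient u g) (hu : u =ᵐ[volume] u')
    (hg : g =ᵐ[volume] g') : HasWeakGradient u' g' where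
  locallyIntegrable := (locallyIntegrable_congr hu).1 h.locallyIntegrable
  locallyIntegrable_grad := (locallyIntegrable_congr hg).1 h.locallyIntegrable_grad
  integral_eq φ hφ hφc v := by
    have h1 := h.integral_eq φ hφ hφc v
    rw [integral_congr_ae (g := fun x => u' x * fderiv ℝ φ x v)
      (by filter_upwards [hu] with x hx; rw [hx]),
      integral_congr_ae (f := fun x => φ x * inner ℝ (g x) v)
      (g := fun x => φ x * inner ℝ (g' x) v)
      (by filter_upwards [hg] with x hx; rw [hx])] at h1
    exact h1

theorem nonlocalEnergy_congr_ae (hp : p =ᵐ[volume] p') (hu : u =ᵐ[volume] u') (δ : ℝ) :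
    nonlocalEnergy p u δ = nonlocalEnergy p' u' δ := by
  refine lintegral_congr_ae ?_
  filter_upwards [hu] with y hy
  have hset : {x | δ < |u x - u y|} =ᵐ[volume] {x | δ < |u' x - u' y|} := by
    filter_upwards [hu] with x hx
    change (δ < |u x - u y|) = (δ < |u' x - u' y|)
    rw [hx, hy]
  rw [Measure.restrict_congr_set hset]
  refine lintegral_congr_ae (ae_restrict_of_ae ?_)
  filter_upwards [hp] with x hx
  rw [hx]

theorem MemW1.memLp_weakGradient {q : ℝ≥0∞} (h : MemW1 q u) (hg : HasWeakGradient u g) :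
    MemLp g q volume := by
  obtain ⟨g₁, hg₁, hL⟩ := h.2
  exact (memLp_congr_ae (hg₁.ae_unique hg)).1 hL

theorem lintegral_ofReal_norm_rpow_lt_top {q : ℝ≥0∞} (hq0 : q ≠ 0) (hq : q ≠ ∞)
    (h : MemLp g q volume) : ∫⁻ x, ENNReal.ofReal (‖g x‖ ^ q.toReal) < ∞ := by
  have h1 := lintegral_rpow_enorm_lt_top_of_eLpNorm_lt_top hq0 hq h.2
  simpa only [← ENNReal.ofReal_rpow_of_nonneg (norm_nonneg _) ENNReal.toReal_nonneg, ofReal_norm]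
    using h1

end VarExp

theorem mainTheorem2 (n : ℕ) (hn : 1 ≤ n)
    (p : EuclideanSpace ℝ (Fin n) → ℝ) (hp_meas : AEMeasurable p volume)
    (hp_one : ∀ x, 1 ≤ p x) (hp_minus : 1 < VarExp.pMinus p) (hp_plus : VarExp.pPlus p < ∞)
    (u : EuclideanSpace ℝ (Fin n) → ℝ) (hu : VarExp.MemW1pm p u)
    (gradu : EuclideanSpace ℝ (Fin n) → EuclideanSpace ℝ (Fin n))
    (hgrad : VarExp.HasWeakGradient u gradu)
    (e : Metric.sphere (0 : EuclideanSpace ℝ (Fin n)) 1) :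
    Tendsto (fun δ : ℝ => VarExp.nonlocalEnergy p u δ) (𝓝[>] 0)
        (𝓝 (∫⁻ x, ENNReal.ofReal (p x * VarExp.K e (p x) * ‖gradu x‖ ^ p x))) ∧
      (∫⁻ x, ENNReal.ofReal (p x * VarExp.K e (p x) * ‖gradu x‖ ^ p x)) < ∞ := by
  have hle : ∀ᵐ x, ENNReal.ofReal (p x) ≤ VarExp.pPlus p := ENNReal.ae_le_essSup _
  have hge : ∀ᵐ x, VarExp.pMinus p ≤ ENNReal.ofReal (p x) := ae_essInf_le
  have hmp : VarExp.pMinus p ≤ VarExp.pPlus p := by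
    obtain ⟨x, h1, h2⟩ := (hge.and hle).exists
    exact h1.trans h2
  have hminus_top : VarExp.pMinus p ≠ ∞ := (hmp.trans_lt hp_plus).ne
  set a := (VarExp.pMinus p).toReal with ha_def
  set b := (VarExp.pPlus p).toReal with hb_def
  have ha : 1 < a := by
    rw [ha_def, ← ENNReal.toReal_one]
    exact (ENNReal.toReal_lt_toReal ENNReal.one_ne_top hminus_top).2 hp_minus
  have hab : a ≤ b := ENNReal.toReal_mono hp_plus.ne hmp
  -- Clamping a measurable representative to `[a, b]` turns the essential bounds into bounds at
  -- every point, changing `p` only on a null set.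
  set p' : EuclideanSpace ℝ (Fin n) → ℝ := fun x => max a (min (hp_meas.mk p x) b) with hp'
  have hpp' : p =ᵐ[volume] p' := by
    filter_upwards [hle, hge, hp_meas.ae_eq_mk] with x h1 h2 h3
    have h4 : p x ≤ b := (ENNReal.ofReal_le_iff_le_toReal hp_plus.ne).1 h1
    have h5 : a ≤ p x := by
      have := ENNReal.toReal_mono ENNReal.ofReal_ne_top h2
      rwa [ENNReal.toReal_ofReal (zero_le_one.trans (hp_one x))] at this
    simp only [hp', ← h3]
    rw [min_eq_left h4, max_eq_right h5]
  have hp'm : Measurable p' := measurable_const.max (hp_meas.measurable_mk.min measurable_const)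
  have hum := hgrad.locallyIntegrable.aestronglyMeasurable
  have hgm := hgrad.locallyIntegrable_grad.aestronglyMeasurable
  have hgg' : gradu =ᵐ[volume] hgm.mk gradu := hgm.ae_eq_mk
  have hLa : MemLp (hgm.mk gradu) (VarExp.pMinus p) volume :=
    (memLp_congr_ae hgg').1 (hu.2.memLp_weakGradient hgrad)
  have hLb : MemLp (hgm.mk gradu) (VarExp.pPlus p) volume :=
    (memLp_congr_ae hgg').1 (hu.1.memLp_weakGradient hgrad)
  have hminus0 : VarExp.pMinus p ≠ 0 := (zero_lt_one.trans hp_minus).ne'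
  have hplus0 : VarExp.pPlus p ≠ 0 := ((zero_lt_one.trans hp_minus).trans_le hmp).ne'
  have key := VarExp.tendsto_nonlocalEnergy hn hp'm hum.stronglyMeasurable_mk.measurable
    hgm.stronglyMeasurable_mk.measurable (hgrad.congr_ae hum.ae_eq_mk hgg') ha
    (fun x => le_max_left _ _) (fun x => max_le hab (min_le_right _ _))
    (VarExp.lintegral_ofReal_norm_rpow_lt_top hminus0 hminus_top hLa)
    (VarExp.lintegral_ofReal_norm_rpow_lt_top hplus0 hp_plus.ne hLb) e
  have hlim : ∫⁻ x, ENNReal.ofReal (p x * VarExp.K e (p x) * ‖gradu x‖ ^ p x)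
      = ∫⁻ x, ENNReal.ofReal (p' x * VarExp.K e (p' x) * ‖hgm.mk gradu x‖ ^ p' x) := by
    refine lintegral_congr_ae ?_
    filter_upwards [hpp', hgg'] with x h1 h2
    rw [h1, h2]
  rw [hlim]
  simp_rw [VarExp.nonlocalEnergy_congr_ae hpp' hum.ae_eq_mk]
  exact key
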